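/- Let $n\ge 1$, $s>0$, and let $\Omega\subset\mathbb R^n$ be a bounded domain (a nonempty, bounded, connected open set) of volume $|\Omega|$; let $\omega_n$ be the volume of the unit ball of $\mathbb R^n$. Write $m(\xi)=|\xi|^{2s}\ln|\xi|^2$ for the Fourier symbol of the fractional-logarithmic Laplacian $(-\Delta)^{s+\ln}$, and $\widehat u(\xi)=(2\pi)^{-n/2}\int_{\mathbb R^n}u(x)e^{-ix\cdot\xi}\,dx$. Let $\mathcal H_0^{s+\ln}(\Omega)$ be the space of all $u\in L^2(\mathbb R^n)$ with $u=0$ a.e. outside $\Omega$ and $\int_{\mathbb R^n}|m(\xi)|\,|\widehat u(\xi)|^2\,d\xi<\infty$ (or, alternatively, the closure of $C_c^\infty(\Omega)$ in that space for the norm $\big(\int_{\mathbb R^n}(1+|m|)|\widehat u|^2\,d\xi\big)^{1/2}$; the result holds for either choice). A Dirichlet eigenvalue of $(-\Delta)^{s+\ln}$ on $\Omega$ is a number $\lambda\in\mathbb R$ for which there is $0\ne u\in\mathcal H_0^{s+\ln}(\Omega)$ with $$\int_{\mathbb R^n}m(\xi)\,\widehat u(\xi)\,\overline{\widehat v(\xi)}\,d\xi=\lambda\int_\Omega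 u\,\overline v\,dx\qquad\text{for all } v\in\mathcal H_0^{s+\ln}(\Omega).$$ Let $\lambda_1^{s+\ln}(\Omega)\le\lambda_2^{s+\ln}(\Omega)\le\cdots$ be these eigenvalues in nondecreasing order, repeated according to multiplicity; that is, $\lambda_k^{s+\ln}(\Omega)$ is the infimum of all $\mu\in\mathbb R$ such that at least $k$ eigenvalues, counted with multiplicity, are $\le\mu$ (with $\inf\emptyset=+\infty$, so that the existence of $k$ eigenvalues is not presupposed). (i) If $k$ is a natural number with $$k>\frac{\omega_n|\Omega|}{(2\pi)^n}\exp\Big(\frac{n}{n+2s}\Big),$$ then $\sum_{j=1}^k\lambda_j^{s+\ln}(\Omega)>0$, and in particular $\lambda_k^{s+\ln}(\Omega)>0$. (ii) If $$|\Omega|<\frac{(2\pi)^n}{\omega_n}\exp\Big(-\frac{n}{n+2s}\Big),$$ then $\lambda_1^{s+\ln}(\Omega)>0$. -/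

import Mathlib

open MeasureTheory
open scoped ContDiff ENNReal ComplexConjugate

namespace FracLog

noncomputable section

/-- The Hilbert space `L²(ℝⁿ; ℂ)`. -/
abbrev L2 (n : ℕ) : Type := Lp ℂ 2 (volume : Measure (EuclideanSpace ℝ (Fin n)))

/-- The volume `ω_n` of the unit ball of `ℝⁿ`. -/
def unitBallVolume (n : ℕ) : ℝ :=
  volume.real (Metric.ball (0 : EuclideanSpace ℝ (Fin n)) 1)

/-- The Fourier transform `û(ξ) = (2π)^{-n/2} ∫ u(x) e^{-i x·ξ} dx`. Below it is only applied to
square integrable functions vanishing outside a bounded set, which are integrable. -/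
def fourier {n : ℕ} (u : EuclideanSpace ℝ (Fin n) → ℂ) (ξ : EuclideanSpace ℝ (Fin n)) : ℂ :=
  (((2 * Real.pi) ^ (-(n : ℝ) / 2) : ℝ) : ℂ) *
    ∫ x, u x * Complex.exp (-(Complex.I * ((inner ℝ x ξ : ℝ) : ℂ)))

/-- The Fourier symbol `|ξ|^{2s} ln |ξ|²` of the fractional-logarithmic Laplacian. -/
def symbol {n : ℕ} (s : ℝ) (ξ : EuclideanSpace ℝ (Fin n)) : ℝ :=
  ‖ξ‖ ^ (2 * s) * Real.log (‖ξ‖ ^ 2)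

/-- The energy space of all functions in `L²(ℝⁿ)` that vanish almost everywhere outside `Ω` and
have finite energy, `∫ |m(ξ)| |û(ξ)|² dξ < ∞` with `m` the symbol. -/
def energySpace {n : ℕ} (s : ℝ) (Ω : Set (EuclideanSpace ℝ (Fin n))) : Set (L2 n) :=
  {u | (∀ᵐ x ∂volume, x ∉ Ω → u x = 0) ∧
    Integrable (fun ξ => |symbol s ξ| * ‖fourier u ξ‖ ^ 2) volume}

/-- The closure of `C_c^∞(Ω)` in the energy space, for the norm whose square is
`∫ (1 + |m(ξ)|) |û(ξ)|² dξ`. -/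
def testClosure {n : ℕ} (s : ℝ) (Ω : Set (EuclideanSpace ℝ (Fin n))) : Set (L2 n) :=
  {u | u ∈ energySpace s Ω ∧
    ∀ ε : ℝ≥0∞, 0 < ε → ∃ φ : EuclideanSpace ℝ (Fin n) → ℂ,
      ContDiff ℝ ∞ φ ∧ HasCompactSupport φ ∧ tsupport φ ⊆ Ω ∧
      ∫⁻ ξ, ENNReal.ofReal ((1 + |symbol s ξ|) * ‖fourier u ξ - fourier φ ξ‖ ^ 2) < ε}

/-- `V` is a Dirichlet form domain `H_0^{s+ln}(Ω)`: both usual versions of this space, which may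
differ when the boundary of `Ω` is irregular, are admitted. -/
def IsDirichletFormDomain {n : ℕ} (s : ℝ) (Ω : Set (EuclideanSpace ℝ (Fin n)))
    (V : Set (L2 n)) : Prop :=
  V = energySpace s Ω ∨ V = testClosure s Ω

/-- The sesquilinear form of the fractional-logarithmic Laplacian,
`𝓔(u, v) = ∫ |ξ|^{2s} ln |ξ|² û(ξ) conj (v̂(ξ)) dξ`. -/
def form {n : ℕ} (s : ℝ) (u v : L2 n) : ℂ :=
  ∫ ξ, (symbol s ξ : ℂ) * (fourier u ξ * conj (fourier v ξ))

/-- The weak solutions `u ∈ V` (zero included) of the eigenvalue equation with parameter `ν`: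
`𝓔(u, v) = ν ∫ u conj v` for all `v ∈ V`. -/
def eigenfunctions {n : ℕ} (s : ℝ) (V : Set (L2 n)) (ν : ℝ) : Set (L2 n) :=
  {u | u ∈ V ∧ ∀ v ∈ V, form s u v = (ν : ℂ) * inner ℂ v u}

/-- The number, counted with multiplicity, of eigenvalues that are at most `μ`, as a cardinal:
the dimension of the span of all eigenfunctions belonging to them. -/
def eigenvalueCount {n : ℕ} (s : ℝ) (V : Set (L2 n)) (μ : ℝ) : Cardinal :=
  Module.rank ℂ (Submodule.span ℂ (⋃ ν ∈ Set.Iic μ, eigenfunctions s V ν))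

/-- The `k`-th eigenvalue (`k ≥ 1`) in nondecreasing order and counted with multiplicity: the
least `μ` such that at least `k` eigenvalues are at most `μ`. The value is taken among the extended
reals only so that the definition does not presuppose that there are `k` eigenvalues. -/
def eigenvalue {n : ℕ} (s : ℝ) (V : Set (L2 n)) (k : ℕ) : EReal :=
  ⨅ (μ : ℝ) (_ : (k : Cardinal) ≤ eigenvalueCount s V μ), (μ : EReal)

end

end FracLog

/-! ### Fourier transform: Plancherel and Bessel -/

namespace FracLog

open scoped FourierTransform

/-! This is a Berezin–Li–Yau argument. For orthonormal `u i` in the energy space put F = ∑ |û_i|².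
Plancherel gives ∫ F = k, and Bessel for the exponentials on Ω gives 0 ≤ F ≤ A with A = |Ω|/(2π)^n.
Let B be the ball of radius R ≥ 1 and c the value of the symbol m on its boundary. Then m ≤ c in B
and m ≥ c outside, so (m - c)(F - A·1_B) ≥ 0, and integrating gives ∫ m F ≥ c k + A ∫_B (m - c). For
R = exp(1/(n+2s)) the integral of m over B vanishes, and the bound becomes c (k - A ω_n R^n) with c
> 0 and R^n = exp(n/(n+2s)); this is `le_sum_re_form`.

No spectral theorem is needed to reach the eigenvalues. Eigenfunctions for different eigenvalues are
orthogonal, so the Rayleigh quotient is at most μ on the span of those with eigenvalue at most μ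
(`re_form_le`). If that span has dimension at least j for μ = μ_j, orthonormal vectors can be picked
one from each span (`exists_orthonormal_mem`), so ∑ μ_j obeys the same lower bound. Taking infima
over the μ_j finishes the proof. -/

/-- The Fourier transform of `FracLog.fourier` is a rescaling of the one of Mathlib. -/
theorem fourier_eq_fourierIntegral {n : ℕ} (u : EuclideanSpace ℝ (Fin n) → ℂ)
    (ξ : EuclideanSpace ℝ (Fin n)) :
    fourier u ξ = (((2 * Real.pi) ^ (-(n : ℝ) / 2) : ℝ) : ℂ) * 𝓕 u ((2 * Real.pi)⁻¹ • ξ) := by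
  rw [fourier, Real.fourier_eq']
  congr 2
  ext x
  rw [smul_eq_mul, mul_comm, inner_smul_right]
  congr 2
  have : (Real.pi : ℂ) ≠ 0 := by exact_mod_cast Real.pi_ne_zero
  push_cast
  field_simp

theorem two_pi_rpow_sq (n : ℕ) :
    ((2 * Real.pi) ^ (-(n : ℝ) / 2)) ^ 2 = ((2 * Real.pi) ^ n)⁻¹ := by
  rw [← Real.rpow_natCast, ← Real.rpow_mul (by positivity), ← Real.rpow_natCast,
    ← Real.rpow_neg (by positivity)]
  congr 1
  push_cast
  ring

theorem continuous_fourierIntegral {E : Type*} [NormedAddCommGroup E] [InnerProductSpace ℝ E]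
    [FiniteDimensional ℝ E] [MeasurableSpace E] [BorelSpace E] {u : E → ℂ} (hu : Integrable u) :
    Continuous (𝓕 u) :=
  VectorFourier.fourierIntegral_continuous (L := innerₗ E) Real.continuous_fourierChar
    continuous_inner hu

theorem continuous_fourier {n : ℕ} {u : EuclideanSpace ℝ (Fin n) → ℂ} (hu : Integrable u) :
    Continuous (fourier u) := by
  have h : fourier u = fun ξ => (((2 * Real.pi) ^ (-(n : ℝ) / 2) : ℝ) : ℂ) *
      𝓕 u ((2 * Real.pi)⁻¹ • ξ) := funext (fourier_eq_fourierIntegral u)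
  rw [h]
  exact continuous_const.mul ((continuous_fourierIntegral hu).comp (continuous_const_smul _))

/-- On integrable square integrable functions, the Fourier transform of `L²` is given by the
Fourier integral. -/
theorem coeFn_fourier_ae_eq_of_integrable {E : Type*} [NormedAddCommGroup E]
    [InnerProductSpace ℝ E] [FiniteDimensional ℝ E] [MeasurableSpace E] [BorelSpace E]
    (u : Lp ℂ 2 (volume : Measure E)) (hu : Integrable u) :
    ((𝓕 u : Lp ℂ 2 (volume : Measure E)) : E → ℂ) =ᵐ[volume] 𝓕 (u : E → ℂ) := by
  -- Both sides are tested against smooth compactly supported functions: the L² transform agrees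
  -- with the distributional one, and Fubini moves the Fourier integral from the test function to
  -- `u`.
  refine ae_eq_of_integral_contDiff_smul_eq
    ((Lp.memLp (𝓕 u)).locallyIntegrable (by norm_num))
    (continuous_fourierIntegral hu).locallyIntegrable fun g hg hgs => ?_
  have hg' : ContDiff ℝ ∞ fun x => (g x : ℂ) := Complex.ofRealCLM.contDiff.comp hg
  have hgs' : HasCompactSupport fun x => (g x : ℂ) :=
    hgs.comp_left (g := fun r : ℝ => (r : ℂ)) Complex.ofReal_zero
  let φ : SchwartzMap E ℂ := hgs'.toSchwartzMap hg'
  have hφ : ∀ x, φ x = (g x : ℂ) := fun x => rfl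
  have h1 := congrArg (fun T => T φ) (Lp.fourier_toTemperedDistribution_eq u)
  simp only [TemperedDistribution.fourier_apply, Lp.toTemperedDistribution_apply] at h1
  have h2 := VectorFourier.integral_fourierIntegral_smul_eq_flip (L := innerₗ E)
    Real.continuous_fourierChar continuous_inner (φ.integrable (μ := volume)) hu
  have h3 : ∫ x, (𝓕 φ) x • u x = ∫ x, φ x • 𝓕 (u : E → ℂ) x := by
    rw [SchwartzMap.fourier_coe]
    simpa using! h2
  rw [h3] at h1
  simp only [hφ] at h1
  simpa [Complex.real_smul] using h1.symm

theorem integral_norm_sq_eq {α : Type*} [MeasurableSpace α] {μ : Measure α} (f : Lp ℂ 2 μ) :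
    ∫ x, ‖f x‖ ^ 2 ∂μ = ‖f‖ ^ 2 := by
  have h := L2.inner_def (𝕜 := ℂ) f f
  rw [inner_self_eq_norm_sq_to_K] at h
  simp only [inner_self_eq_norm_sq_to_K] at h
  have h' : ((‖f‖ ^ 2 : ℝ) : ℂ) = ((∫ x, ‖f x‖ ^ 2 ∂μ : ℝ) : ℂ) := by
    rw [← integral_complex_ofReal]
    simpa using h
  exact (Complex.ofReal_injective h').symm

theorem integrable_norm_sq {α : Type*} [MeasurableSpace α] {μ : Measure α} (f : Lp ℂ 2 μ) :
    Integrable (fun x => ‖f x‖ ^ 2) μ :=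
  (memLp_two_iff_integrable_sq_norm (Lp.aestronglyMeasurable f)).1 (Lp.memLp f)

variable {n : ℕ}

theorem integrable_norm_sq_fourier (u : L2 n) (hu : Integrable u) :
    Integrable fun ξ => ‖fourier u ξ‖ ^ 2 := by
  have h : Integrable fun ξ => ‖𝓕 (u : EuclideanSpace ℝ (Fin n) → ℂ) ξ‖ ^ 2 := by
    refine (integrable_norm_sq (𝓕 u)).congr ?_
    filter_upwards [coeFn_fourier_ae_eq_of_integrable u hu] with ξ hξ
    rw [hξ]
  simp only [fourier_eq_fourierIntegral, norm_mul, mul_pow]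
  exact ((integrable_comp_smul_iff volume _ (R := (2 * Real.pi)⁻¹) (by positivity)).2 h).const_mul _

/-- Plancherel's theorem. -/
theorem integral_norm_sq_fourier (u : L2 n) (hu : Integrable u) :
    ∫ ξ, ‖fourier u ξ‖ ^ 2 = ‖u‖ ^ 2 := by
  have h : ∫ ξ, ‖𝓕 (u : EuclideanSpace ℝ (Fin n) → ℂ) ξ‖ ^ 2 = ‖u‖ ^ 2 := by
    rw [← Lp.norm_fourier_eq u, ← integral_norm_sq_eq]
    refine integral_congr_ae ?_
    filter_upwards [coeFn_fourier_ae_eq_of_integrable u hu] with ξ hξ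
    rw [hξ]
  simp only [fourier_eq_fourierIntegral, norm_mul, mul_pow]
  -- The Jacobian (2π)^n of the rescaling cancels the squared normalising constant.
  rw [integral_const_mul, Measure.integral_comp_smul volume
    (fun ξ => ‖𝓕 (u : EuclideanSpace ℝ (Fin n) → ℂ) ξ‖ ^ 2), h, Complex.norm_real,
    Real.norm_eq_abs, sq_abs, two_pi_rpow_sq, finrank_euclideanSpace_fin, smul_eq_mul,
    abs_of_pos (by positivity), inv_pow, inv_inv, ← mul_assoc, inv_mul_cancel₀ (by positivity),
    one_mul]

theorem integrable_of_vanishing {Ω : Set (EuclideanSpace ℝ (Fin n))} (hΩ : volume Ω ≠ ⊤)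
    (hm : MeasurableSet Ω) (u : L2 n) (hu : ∀ᵐ x ∂volume, x ∉ Ω → u x = 0) : Integrable u := by
  have : IsFiniteMeasure (volume.restrict Ω) := ⟨by simpa using hΩ.lt_top⟩
  have h : IntegrableOn u Ω :=
    ((Lp.memLp u).restrict Ω).integrable (by norm_num)
  refine (integrable_indicator_iff hm |>.2 h).congr ?_
  filter_upwards [hu] with x hx
  by_cases hxΩ : x ∈ Ω <;> simp [hxΩ, hx]

/-- Bessel's inequality for the exponentials on `Ω`. -/
theorem sum_norm_sq_fourier_le {Ω : Set (EuclideanSpace ℝ (Fin n))} (hΩ : volume Ω ≠ ⊤)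
    (hm : MeasurableSet Ω) {ι : Type*} [Fintype ι] (u : ι → L2 n) (ho : Orthonormal ℂ u)
    (hu : ∀ i, ∀ᵐ x ∂volume, x ∉ Ω → u i x = 0) (ξ : EuclideanSpace ℝ (Fin n)) :
    ∑ i, ‖fourier (u i) ξ‖ ^ 2 ≤ volume.real Ω / (2 * Real.pi) ^ n := by
  let e : EuclideanSpace ℝ (Fin n) → ℂ :=
    Ω.indicator fun x => Complex.exp (Complex.I * ((inner ℝ x ξ : ℝ) : ℂ))
  have hnorm : ∀ x, ‖Complex.exp (Complex.I * ((inner ℝ x ξ : ℝ) : ℂ))‖ = 1 := fun x => by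
    rw [mul_comm, Complex.norm_exp_ofReal_mul_I]
  have hcont : Continuous fun x : EuclideanSpace ℝ (Fin n) =>
      Complex.exp (Complex.I * ((inner ℝ x ξ : ℝ) : ℂ)) := by fun_prop
  have hmem : MemLp e 2 volume := by
    rw [memLp_indicator_iff_restrict hm]
    have : IsFiniteMeasure (volume.restrict Ω) := ⟨by simpa using hΩ.lt_top⟩
    exact MemLp.of_bound hcont.aestronglyMeasurable 1 (ae_of_all _ fun x => (hnorm x).le)
  have hsq : ‖hmem.toLp e‖ ^ 2 = volume.real Ω := by
    rw [← integral_norm_sq_eq]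
    have : (fun x => ‖hmem.toLp e x‖ ^ 2) =ᵐ[volume] Ω.indicator 1 := by
      filter_upwards [hmem.coeFn_toLp] with x hx
      rw [hx]
      by_cases hxΩ : x ∈ Ω
      · simp only [e, Set.indicator_of_mem hxΩ, hnorm]; simp
      · simp [e, hxΩ]
    rw [integral_congr_ae this, integral_indicator_one hm]
  -- Since `u i` vanishes off Ω, cutting the exponential off to Ω, which makes it square integrable,
  -- does not change the Fourier integral.
  have hinner : ∀ i, ‖fourier (u i) ξ‖ ^ 2 =
      ((2 * Real.pi) ^ n)⁻¹ * ‖inner ℂ (u i) (hmem.toLp e)‖ ^ 2 := fun i => by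
    rw [fourier, norm_mul, mul_pow, Complex.norm_real, Real.norm_eq_abs, sq_abs, two_pi_rpow_sq,
      norm_inner_symm, L2.inner_def]
    congr 3
    refine integral_congr_ae ?_
    filter_upwards [hmem.coeFn_toLp, hu i] with x hx hux
    rw [hx]
    by_cases hxΩ : x ∈ Ω
    · simp [e, hxΩ, ← Complex.exp_conj]
    · simp [e, hxΩ, hux]
  simp only [hinner]
  rw [← Finset.mul_sum, div_eq_inv_mul]
  gcongr
  exact (ho.sum_inner_products_le (hmem.toLp e)).trans hsq.le

end FracLog

/-! ### The symbol and its integral over a ball -/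

namespace FracLog

/-- Reduces continuity of the symbol at the origin to that of t log t, with t = r^(2s). -/
theorem rpow_mul_log_sq_eq {s : ℝ} (hs : 0 < s) {r : ℝ} (hr : 0 ≤ r) :
    r ^ (2 * s) * Real.log (r ^ 2) = s⁻¹ * (r ^ (2 * s) * Real.log (r ^ (2 * s))) := by
  rcases hr.eq_or_lt with rfl | hr
  · simp [Real.zero_rpow (by positivity : 2 * s ≠ 0)]
  · rw [Real.log_pow, Real.log_rpow hr]
    push_cast
    field_simp

theorem continuous_symbol {n : ℕ} {s : ℝ} (hs : 0 < s) :
    Continuous (symbol s : EuclideanSpace ℝ (Fin n) → ℝ) := by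
  have h : (symbol s : EuclideanSpace ℝ (Fin n) → ℝ) =
      fun ξ => s⁻¹ * (‖ξ‖ ^ (2 * s) * Real.log (‖ξ‖ ^ (2 * s))) :=
    funext fun ξ => rpow_mul_log_sq_eq hs (norm_nonneg ξ)
  rw [h]
  have h' : Continuous fun ξ : EuclideanSpace ℝ (Fin n) => ‖ξ‖ ^ (2 * s) :=
    continuous_norm.rpow_const fun _ => Or.inr (by positivity)
  exact continuous_const.mul (Real.continuous_mul_log.comp h')

/-- The symbol is not monotone in the radius on the unit ball, but it is nonpositive there, while
its value at R ≥ 1 is nonnegative. -/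
theorem symbol_le_of_norm_le {n : ℕ} {s R : ℝ} (hs : 0 < s) (hR : 1 ≤ R)
    {ξ : EuclideanSpace ℝ (Fin n)} (hξ : ‖ξ‖ ≤ R) :
    symbol s ξ ≤ R ^ (2 * s) * Real.log (R ^ 2) := by
  have hlog : 0 ≤ Real.log (R ^ 2) := Real.log_nonneg (one_le_pow₀ hR)
  rw [symbol]
  rcases le_total ‖ξ‖ 1 with h | h
  · have : Real.log (‖ξ‖ ^ 2) ≤ 0 :=
      Real.log_nonpos (by positivity) (pow_le_one₀ (norm_nonneg _) h)
    exact (mul_nonpos_of_nonneg_of_nonpos (by positivity) this).trans (by positivity)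
  · have : Real.log (‖ξ‖ ^ 2) ≤ Real.log (R ^ 2) := by gcongr
    gcongr
    exact Real.log_nonneg (one_le_pow₀ h)

theorem le_symbol_of_le_norm {n : ℕ} {s R : ℝ} (hs : 0 < s) (hR : 1 ≤ R)
    {ξ : EuclideanSpace ℝ (Fin n)} (hξ : R ≤ ‖ξ‖) :
    R ^ (2 * s) * Real.log (R ^ 2) ≤ symbol s ξ := by
  have hlog : 0 ≤ Real.log (R ^ 2) := Real.log_nonneg (one_le_pow₀ hR)
  rw [symbol]
  gcongr

theorem intervalIntegral_radial_symbol {n : ℕ} (hn : 1 ≤ n) {s : ℝ} (hs : 0 < s) :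
    ∫ r in (0 : ℝ)..Real.exp (1 / ((n : ℝ) + 2 * s)),
      r ^ (n - 1) * (r ^ (2 * s) * Real.log (r ^ 2)) = 0 := by
  set R := Real.exp (1 / ((n : ℝ) + 2 * s)) with hR
  have hR0 : 0 < R := Real.exp_pos _
  have hp : 0 < (n : ℝ) + 2 * s := by positivity
  set p := (n : ℝ) + 2 * s with hpdef
  -- The antiderivative (2/p) r^p (log r - 1/p) of 2 r^(p-1) log r; its zero log r = 1/p dictates
  -- the choice of `R`.
  let G : ℝ → ℝ := fun r => 2 / p * (Real.log r * r ^ p) - 2 / p ^ 2 * r ^ p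
  have hG0 : Filter.Tendsto G (nhdsWithin 0 (Set.Ioi 0)) (nhds 0) := by
    have h1 := tendsto_log_mul_rpow_nhdsGT_zero hp
    have h2 : Filter.Tendsto (fun r : ℝ => r ^ p) (nhdsWithin 0 (Set.Ioi 0)) (nhds 0) := by
      have := (Real.continuousAt_rpow_const 0 p (Or.inr hp.le)).tendsto
      rw [Real.zero_rpow hp.ne'] at this
      exact this.mono_left nhdsWithin_le_nhds
    simpa using (h1.const_mul (2 / p)).sub (h2.const_mul (2 / p ^ 2))
  have hderiv : ∀ r, 0 < r →
      HasDerivAt G (r ^ (n - 1) * (r ^ (2 * s) * Real.log (r ^ 2))) r := fun r hr => by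
    have h1 := Real.hasDerivAt_log hr.ne'
    have h2 := Real.hasDerivAt_rpow_const (p := p) (Or.inl hr.ne')
    convert! ((h1.mul h2).const_mul (2 / p)).sub (h2.const_mul (2 / p ^ 2)) using 1
    have e1 : r ^ p = r ^ (p - 1) * r := by
      rw [← Real.rpow_add_one hr.ne', sub_add_cancel]
    have e2 : r ^ (p - 1) = r ^ (n - 1) * r ^ (2 * s) := by
      rw [← Real.rpow_natCast, ← Real.rpow_add hr, Nat.cast_sub hn, hpdef]
      congr 1
      push_cast
      ring
    rw [e1, ← mul_assoc, ← e2, Real.log_pow]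
    push_cast
    field_simp
    ring
  have hint : IntervalIntegrable (fun r : ℝ => r ^ (n - 1) * (r ^ (2 * s) * Real.log (r ^ 2)))
      volume 0 R := by
    have hc : Continuous fun r : ℝ => r ^ (n - 1) *
        (s⁻¹ * (r ^ (2 * s) * Real.log (r ^ (2 * s)))) := by
      have h' : Continuous fun r : ℝ => r ^ (2 * s) :=
        continuous_id.rpow_const fun _ => Or.inr (by positivity)
      exact (continuous_pow _).mul (continuous_const.mul (Real.continuous_mul_log.comp h'))
    refine (hc.intervalIntegrable 0 R).congr fun r hr => ?_
    rw [Set.uIoc_of_le hR0.le] at hr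
    simp only [rpow_mul_log_sq_eq hs hr.1.le]
  have hGR : Filter.Tendsto G (nhdsWithin R (Set.Iio R)) (nhds (G R)) :=
    (hderiv R hR0).continuousAt.tendsto.mono_left nhdsWithin_le_nhds
  rw [intervalIntegral.integral_eq_sub_of_hasDerivAt_of_tendsto hR0
    (fun r hr => hderiv r hr.1) hint hG0 hGR]
  have hlog : Real.log R = 1 / p := by rw [hR, Real.log_exp]
  simp only [G, hlog]
  field_simp
  ring

theorem setIntegral_symbol_ball {n : ℕ} (hn : 1 ≤ n) {s : ℝ} (hs : 0 < s) :
    ∫ ξ in Metric.ball (0 : EuclideanSpace ℝ (Fin n)) (Real.exp (1 / ((n : ℝ) + 2 * s))),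
      symbol s ξ = 0 := by
  have : Nonempty (Fin n) := ⟨⟨0, hn⟩⟩
  set R := Real.exp (1 / ((n : ℝ) + 2 * s)) with hR
  have h : (Metric.ball (0 : EuclideanSpace ℝ (Fin n)) R).indicator (symbol s) =
      fun ξ => (Set.Iio R).indicator (fun r : ℝ => r ^ (2 * s) * Real.log (r ^ 2)) ‖ξ‖ := by
    ext ξ
    by_cases hξ : ‖ξ‖ < R <;> simp [hξ, symbol]
  rw [← integral_indicator measurableSet_ball, h, integral_fun_norm_addHaar volume
    ((Set.Iio R).indicator (fun r : ℝ => r ^ (2 * s) * Real.log (r ^ 2)))]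
  have h2 : ∫ y in Set.Ioi (0 : ℝ), y ^ (Module.finrank ℝ (EuclideanSpace ℝ (Fin n)) - 1) •
      (Set.Iio R).indicator (fun r : ℝ => r ^ (2 * s) * Real.log (r ^ 2)) y = 0 := by
    refine Eq.trans ?_ (intervalIntegral_radial_symbol hn hs)
    rw [intervalIntegral.integral_of_le (Real.exp_pos _).le,
      integral_Ioc_eq_integral_Ioo, ← hR, ← integral_indicator measurableSet_Ioi,
      ← integral_indicator measurableSet_Ioo, finrank_euclideanSpace_fin]
    congr 1
    ext r
    by_cases h0 : 0 < r <;> by_cases h1 : r < R <;> simp [h0, h1]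
  rw [h2]
  simp

theorem volume_real_ball_exp {n : ℕ} (s : ℝ) :
    volume.real (Metric.ball (0 : EuclideanSpace ℝ (Fin n)) (Real.exp (1 / ((n : ℝ) + 2 * s)))) =
      Real.exp ((n : ℝ) / ((n : ℝ) + 2 * s)) * unitBallVolume n := by
  rw [Measure.real, Measure.addHaar_ball_of_pos volume _ (Real.exp_pos _), ENNReal.toReal_mul,
    ENNReal.toReal_ofReal (by positivity), finrank_euclideanSpace_fin, ← Real.exp_nat_mul,
    mul_one_div]
  rfl

end FracLog

/-! ### The quadratic form and its lower bound -/

namespace FracLog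

variable {n : ℕ}

theorem fourier_add {u v : EuclideanSpace ℝ (Fin n) → ℂ} (hu : Integrable u) (hv : Integrable v)
    (ξ : EuclideanSpace ℝ (Fin n)) : fourier (u + v) ξ = fourier u ξ + fourier v ξ := by
  have hexp : ∀ w : EuclideanSpace ℝ (Fin n) → ℂ, Integrable w →
      Integrable fun x => w x * Complex.exp (-(Complex.I * ((inner ℝ x ξ : ℝ) : ℂ))) :=
    fun w hw => hw.mul_bdd (c := 1)
      (Continuous.aestronglyMeasurable (by fun_prop)) (ae_of_all _ fun x => by
        rw [← mul_neg, mul_comm, ← Complex.ofReal_neg, Complex.norm_exp_ofReal_mul_I])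
  simp only [fourier, Pi.add_apply, add_mul]
  rw [integral_add (hexp u hu) (hexp v hv), mul_add]

theorem fourier_smul (c : ℂ) (u : EuclideanSpace ℝ (Fin n) → ℂ)
    (ξ : EuclideanSpace ℝ (Fin n)) : fourier (c • u) ξ = c * fourier u ξ := by
  simp only [fourier, Pi.smul_apply, smul_eq_mul, mul_assoc c]
  rw [integral_const_mul]
  ring

theorem fourier_congr_ae {u v : EuclideanSpace ℝ (Fin n) → ℂ} (h : u =ᵐ[volume] v) :
    fourier u = fourier v := by
  ext ξ
  rw [fourier, fourier]
  congr 1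
  refine integral_congr_ae ?_
  filter_upwards [h] with x hx
  rw [hx]

theorem IsDirichletFormDomain.subset {s : ℝ} {Ω : Set (EuclideanSpace ℝ (Fin n))}
    {V : Set (L2 n)} (hV : IsDirichletFormDomain s Ω V) : V ⊆ energySpace s Ω := by
  rcases hV with rfl | rfl
  · exact subset_rfl
  · exact fun u hu => hu.1

section

variable {s : ℝ} {Ω : Set (EuclideanSpace ℝ (Fin n))}

theorem integrable_of_mem_energySpace (hm : MeasurableSet Ω) (hΩ : volume Ω ≠ ⊤) {u : L2 n}
    (hu : u ∈ energySpace s Ω) : Integrable u :=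
  integrable_of_vanishing hΩ hm u hu.1

theorem integrable_form (hs : 0 < s) (hm : MeasurableSet Ω) (hΩ : volume Ω ≠ ⊤) {u v : L2 n}
    (hu : u ∈ energySpace s Ω) (hv : v ∈ energySpace s Ω) :
    Integrable fun ξ => (symbol s ξ : ℂ) * (fourier u ξ * conj (fourier v ξ)) := by
  have hcu := continuous_fourier (integrable_of_mem_energySpace hm hΩ hu)
  have hcv := continuous_fourier (integrable_of_mem_energySpace hm hΩ hv)
  have hc := continuous_symbol (n := n) hs
  refine (hu.2.add hv.2).mono' (Continuous.aestronglyMeasurable ?_) (ae_of_all _ fun ξ => ?_)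
  · exact (Complex.continuous_ofReal.comp hc).mul (hcu.mul (Complex.continuous_conj.comp hcv))
  · rw [norm_mul, norm_mul, RCLike.norm_conj, Complex.norm_real, Real.norm_eq_abs, Pi.add_apply,
      ← mul_add]
    gcongr
    nlinarith [sq_nonneg (‖fourier u ξ‖ - ‖fourier v ξ‖), sq_nonneg ‖fourier u ξ‖,
      sq_nonneg ‖fourier v ξ‖]

variable (s Ω) in
/-- The energy space as a linear subspace of `L²`. -/
def energySubmodule (hs : 0 < s) (hm : MeasurableSet Ω) (hΩ : volume Ω ≠ ⊤) :
    Submodule ℂ (L2 n) where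
  carrier := energySpace s Ω
  zero_mem' := by
    have h0 : ((0 : L2 n) : EuclideanSpace ℝ (Fin n) → ℂ) =ᵐ[volume] 0 := Lp.coeFn_zero _ _ _
    refine ⟨?_, ?_⟩
    · filter_upwards [h0] with x hx _ using hx
    · rw [fourier_congr_ae h0]
      simp [fourier]
  smul_mem' c u hu := by
    have h0 := Lp.coeFn_smul c u
    refine ⟨?_, ?_⟩
    · filter_upwards [h0, hu.1] with x hx hux hxΩ
      simp [hx, hux hxΩ]
    · rw [fourier_congr_ae h0]
      simp only [fourier_smul, norm_mul, mul_pow]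
      refine (hu.2.const_mul (‖c‖ ^ 2)).congr (ae_of_all _ fun ξ => ?_)
      ring
  add_mem' {u v} hu hv := by
    have h0 := Lp.coeFn_add u v
    have hiu := integrable_of_mem_energySpace hm hΩ hu
    have hiv := integrable_of_mem_energySpace hm hΩ hv
    refine ⟨?_, ?_⟩
    · filter_upwards [h0, hu.1, hv.1] with x hx hux hvx hxΩ
      rw [hx, Pi.add_apply, hux hxΩ, hvx hxΩ, add_zero]
    · rw [fourier_congr_ae h0]
      simp only [fourier_add hiu hiv]
      refine ((hu.2.add hv.2).const_mul 2).mono' (Continuous.aestronglyMeasurable ?_)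
        (ae_of_all _ fun ξ => ?_)
      · exact (continuous_symbol hs).abs.mul
          (((continuous_fourier hiu).add (continuous_fourier hiv)).norm.pow 2)
      · rw [Real.norm_of_nonneg (by positivity), Pi.add_apply, ← mul_add, mul_left_comm]
        gcongr
        have := norm_add_le (fourier u ξ) (fourier v ξ)
        nlinarith [sq_nonneg (‖fourier u ξ‖ - ‖fourier v ξ‖), norm_nonneg (fourier u ξ),
          norm_nonneg (fourier v ξ), norm_nonneg (fourier u ξ + fourier v ξ)]

theorem form_conj_symm (u v : L2 n) : conj (form s v u) = form s u v := by
  rw [form, form, ← integral_conj]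
  congr 1
  ext ξ
  simp [mul_comm]

theorem form_smul_left (c : ℂ) (u v : L2 n) : form s (c • u) v = c * form s u v := by
  rw [form, form, fourier_congr_ae (Lp.coeFn_smul c u), ← integral_const_mul]
  congr 1
  ext ξ
  rw [fourier_smul]
  ring

theorem form_add_left (hs : 0 < s) (hm : MeasurableSet Ω) (hΩ : volume Ω ≠ ⊤) {u v w : L2 n}
    (hu : u ∈ energySpace s Ω) (hv : v ∈ energySpace s Ω) (hw : w ∈ energySpace s Ω) :
    form s (u + v) w = form s u w + form s v w := by
  rw [form, form, form, fourier_congr_ae (Lp.coeFn_add u v),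
    ← integral_add (integrable_form hs hm hΩ hu hw) (integrable_form hs hm hΩ hv hw)]
  congr 1
  ext ξ
  rw [fourier_add (integrable_of_mem_energySpace hm hΩ hu)
    (integrable_of_mem_energySpace hm hΩ hv)]
  ring

theorem re_form_self (u : L2 n) :
    (form s u u).re = ∫ ξ, symbol s ξ * ‖fourier u ξ‖ ^ 2 := by
  have h : form s u u = ((∫ ξ, symbol s ξ * ‖fourier u ξ‖ ^ 2 : ℝ) : ℂ) := by
    rw [form, ← integral_complex_ofReal]
    congr 1
    ext ξ
    rw [Complex.mul_conj, Complex.normSq_eq_norm_sq, ← Complex.ofReal_mul]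
  rw [h, Complex.ofReal_re]

/-- The lower bound for the sums of the quadratic form over orthonormal families: the lowest value
compatible with Plancherel's theorem and Bessel's inequality. -/
theorem le_sum_re_form (hn : 1 ≤ n) (hs : 0 < s) (hm : MeasurableSet Ω) (hΩ : volume Ω ≠ ⊤)
    {k : ℕ} (u : Fin k → L2 n) (ho : Orthonormal ℂ u) (hu : ∀ i, u i ∈ energySpace s Ω) :
    Real.exp (1 / ((n : ℝ) + 2 * s)) ^ (2 * s) *
        Real.log (Real.exp (1 / ((n : ℝ) + 2 * s)) ^ 2) *
      (k - unitBallVolume n * volume.real Ω / (2 * Real.pi) ^ n *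
        Real.exp ((n : ℝ) / ((n : ℝ) + 2 * s))) ≤ ∑ i, (form s (u i) (u i)).re := by
  set R := Real.exp (1 / ((n : ℝ) + 2 * s)) with hR
  set c := R ^ (2 * s) * Real.log (R ^ 2) with hc
  set A := volume.real Ω / (2 * Real.pi) ^ n with hA
  have hR1 : 1 ≤ R := Real.one_le_exp (by positivity)
  have hi := fun i => integrable_of_mem_energySpace hm hΩ (hu i)
  have hi1 : ∀ i, Integrable fun ξ => symbol s ξ * ‖fourier (u i) ξ‖ ^ 2 := fun i => by
    refine (hu i).2.mono' (Continuous.aestronglyMeasurable ?_) (ae_of_all _ fun ξ => ?_)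
    · exact (continuous_symbol hs).mul ((continuous_fourier (hi i)).norm.pow 2)
    · simp
  have hi2 := fun i => integrable_norm_sq_fourier (u i) (hi i)
  let B := Metric.ball (0 : EuclideanSpace ℝ (Fin n)) R
  have hBs : IntegrableOn (symbol s) B :=
    ((continuous_symbol hs).continuousOn.integrableOn_compact
      (isCompact_closedBall (0 : EuclideanSpace ℝ (Fin n)) R)).mono_set Metric.ball_subset_closedBall
  have hBc : IntegrableOn (fun _ : EuclideanSpace ℝ (Fin n) => c) B :=
    integrableOn_const measure_ball_lt_top.ne
  have hB : IntegrableOn (fun ξ => A * (symbol s ξ - c)) B := (hBs.sub hBc).const_mul A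
  -- The bathtub inequality (m - c)(F - A·1_B) ≥ 0, rearranged; Bessel enters only inside the ball.
  have hpt : ∀ ξ : EuclideanSpace ℝ (Fin n), ∑ i, c * ‖fourier (u i) ξ‖ ^ 2 +
      B.indicator (fun ξ => A * (symbol s ξ - c)) ξ ≤ ∑ i, symbol s ξ * ‖fourier (u i) ξ‖ ^ 2 := by
    intro ξ
    have hF := sum_norm_sq_fourier_le hΩ hm u ho (fun i => (hu i).1) ξ
    have hF0 : 0 ≤ ∑ i, ‖fourier (u i) ξ‖ ^ 2 := by positivity
    rw [← Finset.mul_sum, ← Finset.mul_sum]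
    by_cases hξ : ‖ξ‖ < R
    · have := symbol_le_of_norm_le hs hR1 hξ.le
      rw [Set.indicator_of_mem (by simpa [B] using hξ)]
      nlinarith
    · have := le_symbol_of_le_norm hs hR1 (not_lt.1 hξ)
      rw [Set.indicator_of_notMem (by simpa [B] using hξ), add_zero]
      gcongr
  have hint := integral_mono ((integrable_finsetSum _ fun i _ => (hi2 i).const_mul c).add
    (hB.integrable_indicator measurableSet_ball)) (integrable_finsetSum _ fun i _ => hi1 i) hpt
  simp only [Pi.add_apply] at hint
  rw [integral_add (integrable_finsetSum _ fun i _ => (hi2 i).const_mul c)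
    (hB.integrable_indicator measurableSet_ball), integral_finsetSum _ fun i _ => hi1 i,
    integral_finsetSum _ fun i _ => (hi2 i).const_mul c, integral_indicator measurableSet_ball,
    integral_const_mul, integral_sub hBs hBc, setIntegral_symbol_ball hn hs, setIntegral_const,
    volume_real_ball_exp] at hint
  simp only [integral_const_mul, integral_norm_sq_fourier _ (hi _), ho.1, ← re_form_self] at hint
  refine le_trans (le_of_eq ?_) hint
  simp [hA]
  ring

end

end FracLog

/-! ### Spans of eigenfunctions and Rayleigh quotients -/

namespace FracLog

variable {n : ℕ}

section

variable {s : ℝ} {Ω : Set (EuclideanSpace ℝ (Fin n))} {V : Set (L2 n)}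

theorem form_zero_left (u : L2 n) : form s 0 u = 0 := by
  simpa using form_smul_left (s := s) 0 0 u

theorem span_le_energySubmodule (hs : 0 < s) (hm : MeasurableSet Ω) (hΩ : volume Ω ≠ ⊤)
    (hV : V ⊆ energySpace s Ω) : Submodule.span ℂ V ≤ energySubmodule s Ω hs hm hΩ :=
  Submodule.span_le.2 hV

theorem span_eigenfunctions_le (ν : ℝ) :
    Submodule.span ℂ (eigenfunctions s V ν) ≤ Submodule.span ℂ V :=
  Submodule.span_mono fun _ hu => hu.1

/-- Linearity extends the weak equation in the first argument, and Hermitian symmetry then in the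
second. Passing to spans avoids having to show that `V` is a subspace. -/
theorem form_eq_of_mem_span (hs : 0 < s) (hm : MeasurableSet Ω) (hΩ : volume Ω ≠ ⊤)
    (hV : V ⊆ energySpace s Ω) {ν : ℝ} {u v : L2 n}
    (hu : u ∈ Submodule.span ℂ (eigenfunctions s V ν)) (hv : v ∈ Submodule.span ℂ V) :
    form s u v = ν * inner ℂ v u := by
  have hsub := span_le_energySubmodule hs hm hΩ hV
  have hsub' := (span_eigenfunctions_le (s := s) (V := V) ν).trans hsub
  have hleft : ∀ w ∈ V, form s u w = ν * inner ℂ w u := fun w hw => by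
    induction hu using Submodule.span_induction with
    | mem x hx => exact hx.2 w hw
    | zero => simp [form_zero_left]
    | add x y hx hy ihx ihy =>
      rw [form_add_left hs hm hΩ (hsub' hx) (hsub' hy) (hV hw), ihx, ihy, inner_add_right, mul_add]
    | smul c x hx ih => rw [form_smul_left, ih, inner_smul_right]; ring
  have hright : form s v u = ν * inner ℂ u v := by
    induction hv using Submodule.span_induction with
    | mem x hx =>
      rw [← form_conj_symm, hleft x hx, map_mul, inner_conj_symm, Complex.conj_ofReal]
    | zero => simp [form_zero_left]
    | add x y hx hy ihx ihy =>
      rw [form_add_left hs hm hΩ (hsub hx) (hsub hy) (hsub' hu), ihx, ihy, inner_add_right, mul_add]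
    | smul c x hx ih => rw [form_smul_left, ih, inner_smul_right]; ring
  rw [← form_conj_symm, hright, map_mul, inner_conj_symm, Complex.conj_ofReal]

/-- Evaluating the Hermitian form from either side gives (ν - ν')⟨v, u⟩ = 0, because the eigenvalues
are real. -/
theorem inner_eq_zero_of_mem_span (hs : 0 < s) (hm : MeasurableSet Ω) (hΩ : volume Ω ≠ ⊤)
    (hV : V ⊆ energySpace s Ω) {ν ν' : ℝ} (hν : ν ≠ ν') {u v : L2 n}
    (hu : u ∈ Submodule.span ℂ (eigenfunctions s V ν))
    (hv : v ∈ Submodule.span ℂ (eigenfunctions s V ν')) : inner ℂ v u = 0 := by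
  have h1 := form_eq_of_mem_span hs hm hΩ hV hu (span_eigenfunctions_le ν' hv)
  have h2 := form_eq_of_mem_span hs hm hΩ hV hv (span_eigenfunctions_le ν hu)
  rw [← form_conj_symm, h2, map_mul, inner_conj_symm, Complex.conj_ofReal] at h1
  have h3 : ((ν : ℂ) - ν') * inner ℂ v u = 0 := by linear_combination -h1
  refine (mul_eq_zero.1 h3).resolve_left (sub_ne_zero.2 ?_)
  exact_mod_cast hν

theorem form_sum_left (hs : 0 < s) (hm : MeasurableSet Ω) (hΩ : volume Ω ≠ ⊤) {ι : Type*}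
    (t : Finset ι) (f : ι → L2 n) (hf : ∀ i ∈ t, f i ∈ energySpace s Ω) {v : L2 n}
    (hv : v ∈ energySpace s Ω) : form s (∑ i ∈ t, f i) v = ∑ i ∈ t, form s (f i) v := by
  classical
  induction t using Finset.induction_on with
  | empty => simp [form_zero_left]
  | insert a t ha ih =>
    have ht := fun i hi => hf i (Finset.mem_insert_of_mem hi)
    rw [Finset.sum_insert ha, Finset.sum_insert ha, ← ih ht]
    exact form_add_left hs hm hΩ (hf a (Finset.mem_insert_self _ _))
      ((energySubmodule s Ω hs hm hΩ).sum_mem ht) hv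

/-- On the span of the eigenfunctions with eigenvalue at most `μ`, the quadratic form is at most
`μ` times the square of the norm. -/
theorem re_form_le (hs : 0 < s) (hm : MeasurableSet Ω) (hΩ : volume Ω ≠ ⊤)
    (hV : V ⊆ energySpace s Ω) {μ : ℝ} {u : L2 n}
    (hu : u ∈ Submodule.span ℂ (⋃ ν ∈ Set.Iic μ, eigenfunctions s V ν)) :
    (form s u u).re ≤ μ * ‖u‖ ^ 2 := by
  have hsub := span_le_energySubmodule hs hm hΩ hV
  have huV : u ∈ Submodule.span ℂ V :=
    Submodule.span_mono (Set.iUnion₂_subset fun _ _ _ hw => hw.1) hu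
  -- Splits `u` into finitely many mutually orthogonal components `f ν`, which diagonalise both the
  -- form and the norm.
  have hu' : u ∈ ⨆ ν : Set.Iic μ, Submodule.span ℂ (eigenfunctions s V (ν : ℝ)) := by
    rwa [Submodule.span_iUnion₂, iSup_subtype'] at hu
  obtain ⟨f, hf, hfu⟩ := (Submodule.mem_iSup_iff_exists_finsupp _ _).1 hu'
  have hsum : ∑ ν ∈ f.support, f ν = u := hfu
  have hinner : ∀ ν ∈ f.support, inner ℂ u (f ν) = ((‖f ν‖ ^ 2 : ℝ) : ℂ) := fun ν hν => by
    rw [← hsum, sum_inner, Finset.sum_eq_single ν, inner_self_eq_norm_sq_to_K]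
    · simp
    · intro ν' _ hne
      exact inner_eq_zero_of_mem_span hs hm hΩ hV (Subtype.coe_injective.ne hne.symm) (hf ν) (hf ν')
    · exact fun h => absurd hν h
  have hform : form s u u = ((∑ ν ∈ f.support, (ν : ℝ) * ‖f ν‖ ^ 2 : ℝ) : ℂ) := by
    conv_lhs => rw [← hsum]
    rw [hsum, ← hsum, form_sum_left hs hm hΩ _ _
      (fun ν _ => hsub (span_eigenfunctions_le _ (hf ν))) (hsum ▸ hsub huV), hsum,
      Complex.ofReal_sum]
    refine Finset.sum_congr rfl fun ν hν => ?_
    rw [form_eq_of_mem_span hs hm hΩ hV (hf ν) huV, hinner ν hν, ← Complex.ofReal_mul]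
  have hnorm : ‖u‖ ^ 2 = ∑ ν ∈ f.support, ‖f ν‖ ^ 2 := by
    have h : ((‖u‖ ^ 2 : ℝ) : ℂ) = inner ℂ u (∑ ν ∈ f.support, f ν) := by
      rw [hsum, inner_self_eq_norm_sq_to_K]
      simp
    rw [inner_sum, Finset.sum_congr rfl hinner, ← Complex.ofReal_sum] at h
    exact Complex.ofReal_injective h
  rw [hform, Complex.ofReal_re, hnorm, Finset.mul_sum]
  exact Finset.sum_le_sum fun ν _ => mul_le_mul_of_nonneg_right ν.2 (by positivity)

end

/-- An orthonormal family can be chosen from subspaces of increasing dimensions. -/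
theorem exists_orthonormal_mem {H : Type*} [NormedAddCommGroup H] [InnerProductSpace ℂ H]
    (W : ℕ → Submodule ℂ H) (k : ℕ)
    (hW : ∀ j < k, ((j + 1 : ℕ) : Cardinal) ≤ Module.rank ℂ (W j)) :
    ∃ u : Fin k → H, Orthonormal ℂ u ∧ ∀ j : Fin k, u j ∈ W j := by
  induction k with
  | zero => exact ⟨Fin.elim0, ⟨fun i => i.elim0, fun i => i.elim0⟩, fun i => i.elim0⟩
  | succ k ih =>
    obtain ⟨u, hu, huW⟩ := ih fun j hj => hW j (hj.trans k.lt_succ_self)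
    -- A space of dimension at least k + 1 cannot inject into ℂ^k, so it contains a nonzero vector
    -- orthogonal to the k vectors already chosen.
    let L : W k →ₗ[ℂ] (Fin k → ℂ) :=
      LinearMap.pi fun i => (innerₛₗ ℂ (u i)).domRestrict (W k)
    have hL : ¬ Function.Injective L := fun hinj => by
      have h1 := (LinearMap.lift_rank_le_of_injective L hinj)
      rw [rank_fin_fun, Cardinal.lift_natCast, Cardinal.lift_le_nat_iff] at h1
      have h2 := (hW k k.lt_succ_self).trans h1
      exact absurd (Nat.cast_le.1 h2) (by omega)
    obtain ⟨w, hw, hw0⟩ : ∃ w, L w = 0 ∧ w ≠ 0 := by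
      by_contra! h
      exact hL ((injective_iff_map_eq_zero L).2 h)
    have hwu : ∀ i, inner ℂ (u i) (w : H) = 0 := fun i => congrFun hw i
    have hwH : (w : H) ≠ 0 := by simpa using hw0
    let x : H := ((‖(w : H)‖ : ℂ)⁻¹) • (w : H)
    have hx1 : ‖x‖ = 1 := norm_smul_inv_norm hwH
    have hxu : ∀ i, inner ℂ (u i) x = 0 := fun i => by simp [x, hwu]
    refine ⟨Fin.snoc u x, ⟨fun i => ?_, fun i j hij => ?_⟩, fun j => ?_⟩
    · refine Fin.lastCases ?_ (fun i => ?_) i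
      · simpa using hx1
      · simpa using hu.1 i
    · induction i using Fin.lastCases with
      | last =>
        induction j using Fin.lastCases with
        | last => exact absurd rfl hij
        | cast j => simpa using inner_eq_zero_symm.1 (hxu j)
      | cast i =>
        induction j using Fin.lastCases with
        | last => simpa using hxu i
        | cast j => simpa using hu.2 fun h => hij (congrArg _ h)
    · induction j using Fin.lastCases with
      | last => simpa using (W k).smul_mem _ w.2
      | cast j => simpa using huW j

/-! ### Bounds for eigenvalue sums -/

variable (n) in
/-- The lower bound for the sum of the first `k` eigenvalues. -/
noncomputable def eigenvalueSumBound (s : ℝ) (Ω : Set (EuclideanSpace ℝ (Fin n))) (k : ℕ) : ℝ :=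
  Real.exp (1 / ((n : ℝ) + 2 * s)) ^ (2 * s) * Real.log (Real.exp (1 / ((n : ℝ) + 2 * s)) ^ 2) *
    (k - unitBallVolume n * volume.real Ω / (2 * Real.pi) ^ n *
      Real.exp ((n : ℝ) / ((n : ℝ) + 2 * s)))

section

variable {s : ℝ} {Ω : Set (EuclideanSpace ℝ (Fin n))} {V : Set (L2 n)}

theorem eigenvalueSumBound_pos (hs : 0 < s) {k : ℕ}
    (hk : unitBallVolume n * volume.real Ω / (2 * Real.pi) ^ n *
      Real.exp ((n : ℝ) / ((n : ℝ) + 2 * s)) < k) : 0 < eigenvalueSumBound n s Ω k := by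
  have h : 0 < Real.log (Real.exp (1 / ((n : ℝ) + 2 * s)) ^ 2) := by
    rw [Real.log_pow, Real.log_exp]
    positivity
  have := sub_pos.2 hk
  unfold eigenvalueSumBound
  positivity

theorem eigenvalueSumBound_le_sum (hn : 1 ≤ n) (hs : 0 < s) (hm : MeasurableSet Ω)
    (hΩ : volume Ω ≠ ⊤) (hV : V ⊆ energySpace s Ω) (k : ℕ) (μ : ℕ → ℝ)
    (hμ : ∀ j < k, ((j + 1 : ℕ) : Cardinal) ≤ eigenvalueCount s V (μ j)) :
    eigenvalueSumBound n s Ω k ≤ ∑ j ∈ Finset.range k, μ j := by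
  obtain ⟨u, ho, hu⟩ := exists_orthonormal_mem _ k hμ
  have hmem : ∀ i, u i ∈ energySpace s Ω := fun i =>
    span_le_energySubmodule hs hm hΩ hV
      (Submodule.span_mono (Set.iUnion₂_subset fun _ _ _ hw => hw.1) (hu i))
  refine (le_sum_re_form hn hs hm hΩ u ho hmem).trans ?_
  rw [Finset.sum_range]
  refine Finset.sum_le_sum fun i _ => ?_
  simpa [ho.1 i] using re_form_le hs hm hΩ hV (hu i)

theorem eigenvalue_mono {j k : ℕ} (h : j ≤ k) : eigenvalue s V j ≤ eigenvalue s V k :=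
  iInf_mono fun _ => iInf_const_mono fun hμ => (Nat.cast_le.2 h).trans hμ

/-- Keeps sums in `EReal` meaningful, as ⊥ absorbs ⊤. The bound for one eigenvalue serves every
index j ≥ 1; at j = 0 the infimum runs over all reals and equals ⊥. -/
theorem eigenvalue_ne_bot (hn : 1 ≤ n) (hs : 0 < s) (hm : MeasurableSet Ω) (hΩ : volume Ω ≠ ⊤)
    (hV : V ⊆ energySpace s Ω) {j : ℕ} (hj : 1 ≤ j) : eigenvalue s V j ≠ ⊥ := by
  have h : ((eigenvalueSumBound n s Ω 1 : ℝ) : EReal) ≤ eigenvalue s V j :=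
    le_iInf₂ fun μ hμ => by
      have := eigenvalueSumBound_le_sum hn hs hm hΩ hV 1 (fun _ => μ) fun i hi =>
        (Nat.cast_le.2 (by omega)).trans hμ
      exact_mod_cast (by simpa using this)
  exact ((EReal.bot_lt_coe _).trans_le h).ne'

theorem sum_eigenvalue_pos (hn : 1 ≤ n) (hs : 0 < s) (hm : MeasurableSet Ω) (hΩ : volume Ω ≠ ⊤)
    (hV : V ⊆ energySpace s Ω) {k : ℕ} (hk : 0 < eigenvalueSumBound n s Ω k) :
    0 < ∑ j ∈ Finset.range k, eigenvalue s V (j + 1) := by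
  have hbot : ∀ j, eigenvalue s V (j + 1) ≠ ⊥ := fun j =>
    eigenvalue_ne_bot hn hs hm hΩ hV (by omega)
  by_cases htop : ∃ j ∈ Finset.range k, eigenvalue s V (j + 1) = ⊤
  · obtain ⟨j, hj, hjt⟩ := htop
    rw [← Finset.add_sum_erase _ _ hj, hjt, EReal.top_add_of_ne_bot]
    · exact EReal.zero_lt_top
    · exact Finset.sum_induction _ (· ≠ ⊥) (fun a b ha hb => by simp [EReal.add_eq_bot_iff, ha, hb])
        EReal.zero_ne_bot fun i _ => hbot i
  · push Not at htop
    have hcoe : ∑ j ∈ Finset.range k, eigenvalue s V (j + 1) =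
        ((∑ j ∈ Finset.range k, (eigenvalue s V (j + 1)).toReal : ℝ) : EReal) := by
      refine Eq.trans (Finset.sum_congr rfl fun j hj =>
        (EReal.coe_toReal (htop j hj) (hbot j)).symm) ?_
      exact (map_sum (⟨⟨Real.toEReal, EReal.coe_zero⟩, EReal.coe_add⟩ : ℝ →+ EReal) _ _).symm
    rw [hcoe, EReal.coe_pos]
    refine hk.trans_le (le_of_forall_pos_le_add fun ε hε => ?_)
    -- The infimum need not be attained, so each eigenvalue is approximated from above; the k errors
    -- ε/(k+1) add up to at most ε, also for k = 0.
    have hex : ∀ j, ∃ μ : ℝ, j < k → ((j + 1 : ℕ) : Cardinal) ≤ eigenvalueCount s V μ ∧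
        μ < (eigenvalue s V (j + 1)).toReal + ε / (k + 1) := fun j => by
      by_cases hj : j < k
      · have hlt : eigenvalue s V (j + 1) <
            (((eigenvalue s V (j + 1)).toReal + ε / (k + 1) : ℝ) : EReal) := by
          conv_lhs => rw [← EReal.coe_toReal (htop j (Finset.mem_range.2 hj)) (hbot j)]
          rw [EReal.coe_lt_coe_iff]
          linarith [show 0 < ε / (k + 1) by positivity]
        conv_lhs at hlt => rw [eigenvalue]
        simp only [iInf_lt_iff] at hlt
        obtain ⟨μ, h1, h2⟩ := hlt
        exact ⟨μ, fun _ => ⟨h1, EReal.coe_lt_coe_iff.1 h2⟩⟩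
      · exact ⟨0, fun h => absurd h hj⟩
    choose μ hμ using hex
    refine (eigenvalueSumBound_le_sum hn hs hm hΩ hV k μ fun j hj => (hμ j hj).1).trans ?_
    refine (Finset.sum_le_sum fun j hj => (hμ j (Finset.mem_range.1 hj)).2.le).trans ?_
    rw [Finset.sum_add_distrib, Finset.sum_const, Finset.card_range, nsmul_eq_mul]
    have : (k : ℝ) * (ε / (k + 1)) ≤ ε := by
      rw [mul_div_left_comm]
      exact mul_le_of_le_one_right hε.le ((div_le_one (by positivity)).2 (by linarith))
    linarith

end

end FracLog

/-! ### Conclusion -/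

theorem corollary2p7 (n : ℕ) (hn : 1 ≤ n) (s : ℝ) (hs : 0 < s)
    (Ω : Set (EuclideanSpace ℝ (Fin n)))
    (hΩopen : IsOpen Ω) (hΩconn : IsConnected Ω) (hΩbdd : Bornology.IsBounded Ω)
    (V : Set (FracLog.L2 n)) (hV : FracLog.IsDirichletFormDomain s Ω V) :
    (∀ k : ℕ,
      FracLog.unitBallVolume n * volume.real Ω / (2 * Real.pi) ^ n *
          Real.exp ((n : ℝ) / ((n : ℝ) + 2 * s)) < (k : ℝ) →
        0 < ∑ j ∈ Finset.Icc 1 k, FracLog.eigenvalue s V j ∧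
        0 < FracLog.eigenvalue s V k) ∧
    (volume.real Ω <
        (2 * Real.pi) ^ n / FracLog.unitBallVolume n *
          Real.exp (-((n : ℝ) / ((n : ℝ) + 2 * s))) →
      0 < FracLog.eigenvalue s V 1) := by
  have hball : 0 < FracLog.unitBallVolume n :=
    ENNReal.toReal_pos (Metric.measure_ball_pos _ _ one_pos).ne' measure_ball_lt_top.ne
  have main : ∀ k : ℕ,
      FracLog.unitBallVolume n * volume.real Ω / (2 * Real.pi) ^ n *
          Real.exp ((n : ℝ) / ((n : ℝ) + 2 * s)) < (k : ℝ) →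
        0 < ∑ j ∈ Finset.Icc 1 k, FracLog.eigenvalue s V j ∧
        0 < FracLog.eigenvalue s V k := fun k hk => by
    have hsum : 0 < ∑ j ∈ Finset.Icc 1 k, FracLog.eigenvalue s V j := by
      have h := FracLog.sum_eigenvalue_pos hn hs hΩopen.measurableSet hΩbdd.measure_lt_top.ne
        hV.subset (FracLog.eigenvalueSumBound_pos hs hk)
      rwa [Finset.range_eq_Ico, Finset.sum_Ico_add' (FracLog.eigenvalue s V) 0 k 1, zero_add,
        Finset.Ico_add_one_right_eq_Icc] at h
    -- If the largest summand were nonpositive, so would be the whole sum.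
    refine ⟨hsum, lt_of_not_ge fun hle => hsum.not_ge (Finset.sum_nonpos fun j hj => ?_)⟩
    exact (FracLog.eigenvalue_mono (Finset.mem_Icc.1 hj).2).trans hle
  -- The volume condition in (ii) is the condition of (i) for k = 1, solved for |Ω|.
  refine ⟨main, fun h => (main 1 ?_).2⟩
  rw [Real.exp_neg, div_mul_eq_mul_div, lt_div_iff₀ hball, ← div_eq_mul_inv,
    lt_div_iff₀ (Real.exp_pos _)] at h
  rw [div_mul_eq_mul_div, div_lt_iff₀ (by positivity)]
  push_cast
  linarith
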